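/- Let $K$ be a field, let $A$ be a finitely generated (associative, unital) $K$-algebra that is a simple ring, and let $G$ be a finite group of $K$-algebra automorphisms of $A$ such that $|G|$ is invertible in $A$. Let $A^G=\{a\in A : g(a)=a \text{ for all } g\in G\}$ be the fixed algebra. Then $A^G$ is a finitely generated $K$-algebra, and for every nonzero finitely generated left $A^G$-module $M$, $$\mathrm{GK}(M)\ \ge\ h_A\ \ge\ \frac{\mathrm{GK}(A)}{\mathrm{fdim}(A)+\max\{\mathrm{fdim}(A),1\}}.$$ (The second inequality does not involve $M$.) All quantities take values in $[0,\infty]$, and the fraction is read as $0$ if $\mathrm{fdim}(A)=\infty$. The notation is as follows. For $f:\mathbb N\to\mathbb N\cup\{\infty\}$ the degree is $\gamma(f)=\inf\{r\in\mathbb R_{\ge 0} : f(i)\le i^r \text{ for all } i\gg 0\}\in[0,\infty]$, with $\inf\emptyset=\infty$. For a subspace $V$ of a $K$-algebra $B$ and a subspace $M_0$ of a left $B$-module $M$, put $B_i=(K+V)^i$ and $M_i=B_iM_0$ (products of subspaces are linear spans of products). The Gelfand–Kirillov dimensions $\mathrm{GK}(B)$ and $\mathrm{GK}(M)$ are the suprema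 of $\gamma(i\mapsto\dim_K B_i)$ and of $\gamma(i\mapsto \dim_K M_i)$ over all finite dimensional $V\subseteq B$ and $M_0\subseteq M$. For a finitely generated algebra $B$ and a finitely generated module $M$, these are the values for any one choice of finite dimensional subspaces $V$ generating the algebra $B$ and $M_0$ generating the module $M$. The holonomic number is $h_A=\inf\{\mathrm{GK}(M) : M\ne 0 \text{ a finitely generated left } A\text{-module}\}$. For a finitely generated algebra $B$, a finitely generated left $B$-module $M$ and finite dimensional generating subspaces $V\subseteq B$, $M_0\subseteq M$, the return function is $$\nu(i)=\min\{\,j\in\mathbb N\cup\{\infty\} : M_0\subseteq B_jN \text{ for every subspace } N\subseteq M_i \text{ with } BN=M\,\},$$ where $\nu(i)=\infty$ if no finite $j$ works, and the filter dimension is $\mathrm{fdim}(M)=\gamma(\nu)$, which does not depend on the choice of $V$ and $M_0$. Finally $\mathrm{fdim}(A)$ is the filter dimension of the bimodule ${}_AA_A$, that is, of $A$ as a left module over $A\otimes_K A^{op}$. -/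

import Mathlib

open Filter
open scoped ENNReal NNReal TensorProduct

universe u

/-- The degree `γ(f)` of a function `f : ℕ → ℕ ∪ {∞}`: the infimum, in `[0, ∞]`, of the real
numbers `r ≥ 0` such that `f i ≤ i ^ r` for all sufficiently large `i`. -/
noncomputable def growthDegree (f : ℕ → ℕ∞) : ℝ≥0∞ :=
  ⨅ (r : ℝ≥0) (_ : ∀ᶠ i : ℕ in atTop, ((f i : ℕ∞) : ℝ≥0∞) ≤ (i : ℝ≥0∞) ^ (r : ℝ)), (r : ℝ≥0∞)

/-- The filtration `A_i = (K + V) ^ i` of an algebra attached to a subspace `V`; it is the standard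
filtration if `V` is spanned by a finite set of algebra generators. -/
def algFiltration {K A : Type*} [Field K] [Ring A] [Algebra K A]
    (V : Submodule K A) (i : ℕ) : Submodule K A :=
  ((1 : Submodule K A) ⊔ V) ^ i

/-- The filtration `M_i = A_i M_0` of a module. -/
def modFiltration {K A M : Type*} [Field K] [Ring A] [Algebra K A] [AddCommGroup M] [Module K M]
    [Module A M] [IsScalarTower K A M]
    (V : Submodule K A) (M₀ : Submodule K M) (i : ℕ) : Submodule K M :=
  algFiltration V i • M₀

/-- The Gelfand–Kirillov dimension of an algebra: the supremum, over the finite dimensional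
subspaces `V`, of the degree of `i ↦ dim (K + V) ^ i`. For a finitely generated algebra this is the
degree for any one finite dimensional generating subspace, see `algGKDim_eq`. -/
noncomputable def algGKDim (K A : Type*) [Field K] [Ring A] [Algebra K A] : ℝ≥0∞ :=
  ⨆ (V : Submodule K A) (_ : V.FG),
    growthDegree fun i => (Module.finrank K (algFiltration V i) : ℕ∞)

/-- The Gelfand–Kirillov dimension of a left module: the supremum, over the finite dimensional
subspaces `V ⊆ A` and `M₀ ⊆ M`, of the degree of `i ↦ dim ((K + V) ^ i M₀)`. For a finitely
generated module over a finitely generated algebra this is the degree for any one choice of finite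
dimensional generating subspaces, see `modGKDim_eq`. -/
noncomputable def modGKDim (K A M : Type*) [Field K] [Ring A] [Algebra K A] [AddCommGroup M]
    [Module K M] [Module A M] [IsScalarTower K A M] : ℝ≥0∞ :=
  ⨆ (V : Submodule K A) (_ : V.FG) (M₀ : Submodule K M) (_ : M₀.FG),
    growthDegree fun i => (Module.finrank K (modFiltration V M₀ i) : ℕ∞)

/-- The holonomic number `h_A`: the infimum of the Gelfand–Kirillov dimensions of the nonzero
finitely generated left `A`-modules. -/
noncomputable def holonomicNumber (K : Type*) (A : Type u) [Field K] [Ring A] [Algebra K A] :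
    ℝ≥0∞ :=
  ⨅ (M : Type u) (_ : AddCommGroup M) (_ : Module K M) (_ : Module A M)
    (_ : IsScalarTower K A M) (_ : Nontrivial M) (_ : Module.Finite A M), modGKDim K A M

/-- The return function of an `A`-module: `ν(i)` is the least `j ∈ ℕ ∪ {∞}` such that
`M₀ ⊆ A_j N` for every subspace `N ⊆ M_i` that generates the `A`-module `M`. -/
noncomputable def returnFunction {K A M : Type*} [Field K] [Ring A] [Algebra K A] [AddCommGroup M]
    [Module K M] [Module A M] [IsScalarTower K A M]
    (V : Submodule K A) (M₀ : Submodule K M) (i : ℕ) : ℕ∞ :=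
  ⨅ (j : ℕ) (_ : ∀ N : Submodule K M, N ≤ modFiltration V M₀ i →
    Submodule.span A (N : Set M) = ⊤ → M₀ ≤ algFiltration V j • N), (j : ℕ∞)

/-- The filter dimension of a finitely generated module over a finitely generated algebra: the
degree of the return function, where `V` and `M₀` are finite dimensional subspaces that generate the
algebra and the module. The degree is the same for all choices, see `modFilterDim_eq`; the supremum
over the choices is their common value. -/
noncomputable def modFilterDim (K A M : Type*) [Field K] [Ring A] [Algebra K A] [AddCommGroup M]
    [Module K M] [Module A M] [IsScalarTower K A M] : ℝ≥0∞ :=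
  ⨆ (V : Submodule K A) (_ : V.FG) (_ : Algebra.adjoin K (V : Set A) = ⊤)
    (M₀ : Submodule K M) (_ : M₀.FG) (_ : Submodule.span A (M₀ : Set M) = ⊤),
    growthDegree (returnFunction V M₀)

/-- The `A`-bimodule `A` as a left module over `A ⊗ Aᵒᵖ`, with `(a ⊗ b) • x = a * x * b`. -/
noncomputable abbrev envelopingModule (K A : Type*) [Field K] [Ring A] [Algebra K A] :
    Module (A ⊗[K] Aᵐᵒᵖ) A :=
  TensorProduct.Algebra.module

theorem envelopingModule_tmul_smul (K A : Type*) [Field K] [Ring A] [Algebra K A] (a x : A)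
    (b : Aᵐᵒᵖ) :
    letI := envelopingModule K A
    (a ⊗ₜ[K] b) • x = a * x * b.unop := by
  let _ := envelopingModule K A
  rw [TensorProduct.Algebra.smul_def, MulOpposite.smul_eq_mul_unop, smul_eq_mul, mul_assoc]

theorem envelopingModule_isScalarTower (K A : Type*) [Field K] [Ring A] [Algebra K A] :
    let _ := envelopingModule K A
    IsScalarTower K (A ⊗[K] Aᵐᵒᵖ) A := by
  let _ := envelopingModule K A
  refine ⟨fun k t x => ?_⟩
  change TensorProduct.Algebra.moduleAux _ _ = _ • TensorProduct.Algebra.moduleAux _ _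
  rw [map_smul, LinearMap.smul_apply]

/-- The filter dimension of an algebra `A`: the filter dimension of the bimodule `A`, that is, of
the left `A ⊗ Aᵒᵖ`-module `A`. -/
noncomputable def algFilterDim (K A : Type*) [Field K] [Ring A] [Algebra K A] : ℝ≥0∞ :=
  letI := envelopingModule K A
  haveI := envelopingModule_isScalarTower K A
  modFilterDim K (A ⊗[K] Aᵐᵒᵖ) A

theorem growthDegree_le_of_le {f g : ℕ → ℕ∞} (C c d : ℕ)
    (h : ∀ i, f i ≤ C * g (c * i + d) + C) (hc : 1 ≤ c) : growthDegree f ≤ growthDegree g := by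
  unfold growthDegree
  refine le_iInf₂ fun r hr => ?_
  refine ENNReal.le_of_forall_pos_le_add fun ε hε _ => ?_
  rw [← ENNReal.coe_add]
  refine iInf₂_le (r + ε) ?_
  have ht : Tendsto (fun i : ℕ => c * i + d) atTop atTop :=
    tendsto_atTop_mono (fun i => (Nat.le_mul_of_pos_left i hc).trans (Nat.le_add_right _ _)) tendsto_id
  have hlim : Tendsto (fun i : ℕ => (i : ℝ) ^ (ε : ℝ)) atTop atTop :=
    (tendsto_rpow_atTop (by exact_mod_cast hε)).comp tendsto_natCast_atTop_atTop
  filter_upwards [ht.eventually hr, eventually_ge_atTop 1,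
    hlim.eventually_ge_atTop ((C : ℝ) * ((c + d : ℕ) : ℝ) ^ (r : ℝ) + C)] with i h1 h2 h3
  have hi1 : (1 : ℝ) ≤ i := by exact_mod_cast h2
  have hreal : (C : ℝ) * ((c * i + d : ℕ) : ℝ) ^ (r : ℝ) + C ≤ (i : ℝ) ^ ((r + ε : ℝ≥0) : ℝ) := by
    have e1 : ((c * i + d : ℕ) : ℝ) ^ (r : ℝ) ≤ ((c + d : ℕ) : ℝ) ^ (r : ℝ) * (i : ℝ) ^ (r : ℝ) := by
      rw [← Real.mul_rpow (by positivity) (by positivity)]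
      refine Real.rpow_le_rpow (by positivity) ?_ r.2
      push_cast
      nlinarith [(Nat.cast_nonneg d : (0 : ℝ) ≤ d)]
    have e2 : (1 : ℝ) ≤ (i : ℝ) ^ (r : ℝ) := Real.one_le_rpow hi1 r.2
    rw [NNReal.coe_add, Real.rpow_add (by positivity)]
    have e3 := mul_le_mul_of_nonneg_left h3 (zero_le_one.trans e2)
    have hC : (0 : ℝ) ≤ C := Nat.cast_nonneg C
    have e4 := mul_le_mul_of_nonneg_left e1 hC
    have e5 := mul_le_mul_of_nonneg_left e2 hC
    nlinarith
  have hf : ((f i : ℕ∞) : ℝ≥0∞) ≤ C * ((g (c * i + d) : ℕ∞) : ℝ≥0∞) + C := by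
    have := ENat.toENNReal_mono (h i)
    simpa using this
  have key : (C : ℝ≥0∞) * ((c * i + d : ℕ) : ℝ≥0∞) ^ (r : ℝ) + C
      ≤ (i : ℝ≥0∞) ^ ((r + ε : ℝ≥0) : ℝ) := by
    have hn : (C : ℝ≥0) * ((c * i + d : ℕ) : ℝ≥0) ^ (r : ℝ) + C
        ≤ (i : ℝ≥0) ^ ((r + ε : ℝ≥0) : ℝ) := by
      rw [← NNReal.coe_le_coe]
      simpa using hreal
    have hn' := ENNReal.coe_le_coe.2 hn
    rw [ENNReal.coe_rpow_of_nonneg _ (NNReal.coe_nonneg (r + ε)), ENNReal.coe_add, ENNReal.coe_mul,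
      ENNReal.coe_rpow_of_nonneg _ (NNReal.coe_nonneg r)] at hn'
    exact_mod_cast hn'
  calc ((f i : ℕ∞) : ℝ≥0∞) ≤ C * ((g (c * i + d) : ℕ∞) : ℝ≥0∞) + C := hf
    _ ≤ (C : ℝ≥0∞) * ((c * i + d : ℕ) : ℝ≥0∞) ^ (r : ℝ) + C := by gcongr
    _ ≤ _ := key

section Independence

variable {K A M : Type*} [Field K] [Ring A] [Algebra K A] [AddCommGroup M] [Module K M]
  [Module A M] [IsScalarTower K A M]

theorem algFiltration_mono (V : Submodule K A) : Monotone (algFiltration V) :=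
  pow_right_mono₀ (le_sup_left : (1 : Submodule K A) ≤ 1 ⊔ V)

theorem algFiltration_fg {V : Submodule K A} (hV : V.FG) (i : ℕ) : (algFiltration V i).FG :=
  Submodule.FG.pow (Submodule.FG.sup
    (by rw [Submodule.one_eq_span]; exact Submodule.fg_span_singleton 1) hV) i

theorem modFiltration_fg {V : Submodule K A} {M₀ : Submodule K M} (hV : V.FG) (hM : M₀.FG)
    (i : ℕ) : (modFiltration V M₀ i).FG := by
  obtain ⟨s, hs⟩ := algFiltration_fg hV i
  obtain ⟨t, ht⟩ := hM
  have : modFiltration V M₀ i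
      = Submodule.map₂ (Algebra.lsmul K K M : A →ₐ[K] Module.End K M).toLinearMap
        (algFiltration V i) M₀ := by
    apply le_antisymm
    · exact Submodule.smul_le.2 fun a ha m hm => Submodule.apply_mem_map₂ _ ha hm
    · exact Submodule.map₂_le.2 fun a ha m hm => Submodule.smul_mem_smul ha hm
  rw [this]
  exact Submodule.FG.map₂ _ ⟨s, hs⟩ ⟨t, ht⟩

theorem mem_algFiltration {V : Submodule K A} (hV : Algebra.adjoin K (V : Set A) = ⊤) (a : A) :
    ∃ n, a ∈ algFiltration V n := by
  have ha : a ∈ Algebra.adjoin K (V : Set A) := by rw [hV]; trivial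
  induction ha using Algebra.adjoin_induction with
  | mem x hx => exact ⟨1, by rw [algFiltration, pow_one]; exact Submodule.mem_sup_right hx⟩
  | algebraMap r =>
    exact ⟨0, by rw [algFiltration, pow_zero]; exact Submodule.algebraMap_mem r⟩
  | add x y _ _ hx hy =>
    obtain ⟨m, hm⟩ := hx
    obtain ⟨n, hn⟩ := hy
    exact ⟨max m n, add_mem (algFiltration_mono V (le_max_left m n) hm)
      (algFiltration_mono V (le_max_right m n) hn)⟩
  | mul x y _ _ hx hy =>
    obtain ⟨m, hm⟩ := hx
    obtain ⟨n, hn⟩ := hy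
    exact ⟨m + n, by rw [algFiltration, pow_add]; exact Submodule.mul_mem_mul hm hn⟩

theorem mem_modFiltration {V : Submodule K A} {M₀ : Submodule K M}
    (hV : Algebra.adjoin K (V : Set A) = ⊤) (hM : Submodule.span A (M₀ : Set M) = ⊤) (x : M) :
    ∃ n, x ∈ modFiltration V M₀ n := by
  have hx : x ∈ Submodule.span A (M₀ : Set M) := by rw [hM]; trivial
  induction hx using Submodule.span_induction with
  | mem x hx => exact ⟨0, by rw [modFiltration, algFiltration, pow_zero, Submodule.one_smul]; exact hx⟩
  | zero => exact ⟨0, zero_mem _⟩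
  | add x y _ _ hx hy =>
    obtain ⟨m, hm⟩ := hx
    obtain ⟨n, hn⟩ := hy
    exact ⟨max m n, add_mem
      (Submodule.smul_mono_left (algFiltration_mono V (le_max_left m n)) hm)
      (Submodule.smul_mono_left (algFiltration_mono V (le_max_right m n)) hn)⟩
  | smul a x _ hx =>
    obtain ⟨n, hn⟩ := hx
    obtain ⟨m, hm⟩ := mem_algFiltration hV a
    refine ⟨m + n, ?_⟩
    rw [modFiltration, algFiltration, pow_add, ← smul_eq_mul, Submodule.smul_assoc]
    exact Submodule.smul_mem_smul hm hn

theorem le_algFiltration {V W : Submodule K A} (hV : Algebra.adjoin K (V : Set A) = ⊤)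
    (hW : W.FG) : ∃ n, W ≤ algFiltration V n := by
  induction W, hW using Submodule.fg_induction with
  | singleton x =>
    obtain ⟨n, hn⟩ := mem_algFiltration hV x
    exact ⟨n, by rwa [Submodule.span_singleton_le_iff_mem]⟩
  | sup N P _ _ hN hP =>
    obtain ⟨m, hm⟩ := hN
    obtain ⟨n, hn⟩ := hP
    exact ⟨max m n, sup_le (hm.trans (algFiltration_mono V (le_max_left m n)))
      (hn.trans (algFiltration_mono V (le_max_right m n)))⟩

theorem le_modFiltration {V : Submodule K A} {M₀ N : Submodule K M}
    (hV : Algebra.adjoin K (V : Set A) = ⊤) (hM : Submodule.span A (M₀ : Set M) = ⊤)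
    (hN : N.FG) : ∃ n, N ≤ modFiltration V M₀ n := by
  induction N, hN using Submodule.fg_induction with
  | singleton x =>
    obtain ⟨n, hn⟩ := mem_modFiltration hV hM x
    exact ⟨n, by rwa [Submodule.span_singleton_le_iff_mem]⟩
  | sup N P _ _ hN hP =>
    obtain ⟨m, hm⟩ := hN
    obtain ⟨n, hn⟩ := hP
    exact ⟨max m n, sup_le
      (hm.trans (Submodule.smul_mono_left (algFiltration_mono V (le_max_left m n))))
      (hn.trans (Submodule.smul_mono_left (algFiltration_mono V (le_max_right m n))))⟩

theorem exists_algFiltration_le {V W : Submodule K A} (hV : Algebra.adjoin K (V : Set A) = ⊤)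
    (hW : W.FG) : ∃ c, 1 ≤ c ∧ ∀ i, algFiltration W i ≤ algFiltration V (c * i) := by
  obtain ⟨n, hn⟩ := le_algFiltration hV hW
  refine ⟨n + 1, by omega, fun i => ?_⟩
  rw [algFiltration, algFiltration, pow_mul]
  refine pow_le_pow_left' (sup_le ?_ (hn.trans (algFiltration_mono V n.le_succ))) i
  exact one_le_pow₀ (le_sup_left : (1 : Submodule K A) ≤ 1 ⊔ V)

theorem exists_modFiltration_le {V W : Submodule K A} {M₀ N₀ : Submodule K M}
    (hV : Algebra.adjoin K (V : Set A) = ⊤) (hM : Submodule.span A (M₀ : Set M) = ⊤)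
    (hW : W.FG) (hN : N₀.FG) :
    ∃ c d, 1 ≤ c ∧ ∀ i, modFiltration W N₀ i ≤ modFiltration V M₀ (c * i + d) := by
  obtain ⟨c, hc, h⟩ := exists_algFiltration_le hV hW
  obtain ⟨d, hd⟩ := le_modFiltration hV hM hN
  refine ⟨c, d, hc, fun i => ?_⟩
  refine (Submodule.smul_mono (h i) hd).trans ?_
  rw [modFiltration, modFiltration, ← Submodule.smul_assoc, smul_eq_mul]
  simp only [algFiltration, pow_add]
  exact le_rfl

theorem algGKDim_eq {V : Submodule K A} (hV : V.FG) (hV' : Algebra.adjoin K (V : Set A) = ⊤) :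
    algGKDim K A = growthDegree fun i => (Module.finrank K (algFiltration V i) : ℕ∞) := by
  apply le_antisymm
  · refine iSup₂_le fun W hW => ?_
    obtain ⟨c, hc, h⟩ := exists_algFiltration_le hV' hW
    refine growthDegree_le_of_le 1 c 0 (fun i => ?_) hc
    have := Module.Finite.of_fg (algFiltration_fg hV (c * i))
    have h1 := Submodule.finrank_mono (h i)
    have h2 : (Module.finrank K (algFiltration W i) : ℕ∞)
        ≤ (Module.finrank K (algFiltration V (c * i)) : ℕ∞) := by exact_mod_cast h1
    simpa using h2.trans le_self_add
  · exact le_iSup₂_of_le V hV le_rfl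

theorem modGKDim_eq {V : Submodule K A} {M₀ : Submodule K M} (hV : V.FG)
    (hV' : Algebra.adjoin K (V : Set A) = ⊤) (hM : M₀.FG)
    (hM' : Submodule.span A (M₀ : Set M) = ⊤) :
    modGKDim K A M = growthDegree fun i => (Module.finrank K (modFiltration V M₀ i) : ℕ∞) := by
  apply le_antisymm
  · refine iSup₂_le fun W hW => iSup₂_le fun N hN => ?_
    obtain ⟨c, d, hc, h⟩ := exists_modFiltration_le hV' hM' hW hN
    refine growthDegree_le_of_le 1 c d (fun i => ?_) hc
    have := Module.Finite.of_fg (modFiltration_fg hV hM (c * i + d))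
    have h1 := Submodule.finrank_mono (h i)
    have h2 : (Module.finrank K (modFiltration W N i) : ℕ∞)
        ≤ (Module.finrank K (modFiltration V M₀ (c * i + d)) : ℕ∞) := by exact_mod_cast h1
    simpa using h2.trans le_self_add
  · exact le_iSup₂_of_le V hV (le_iSup₂_of_le M₀ hM le_rfl)

theorem modFilterDim_eq {V : Submodule K A} {M₀ : Submodule K M} (hV : V.FG)
    (hV' : Algebra.adjoin K (V : Set A) = ⊤) (hM : M₀.FG)
    (hM' : Submodule.span A (M₀ : Set M) = ⊤) :
    modFilterDim K A M = growthDegree (returnFunction V M₀) := by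
  apply le_antisymm
  · refine iSup_le fun W => iSup₂_le fun hW hW' => iSup_le fun N => iSup₂_le fun hN hN' => ?_
    obtain ⟨c, d, hc, h⟩ := exists_modFiltration_le hV' hM' hW hN
    obtain ⟨e, he⟩ := le_modFiltration hV' hM' hN
    obtain ⟨b, hb1, hb⟩ := exists_algFiltration_le hW' hV
    refine growthDegree_le_of_le (b * (e + 1)) c d (fun i => ?_) hc
    cases hν : returnFunction V M₀ (c * i + d) with
    | top =>
      rw [ENat.mul_top (by norm_cast; positivity)]
      simp
    | coe j =>
      have hj : ∀ P : Submodule K M, P ≤ modFiltration V M₀ (c * i + d) →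
          Submodule.span A (P : Set M) = ⊤ → M₀ ≤ algFiltration V j • P := by
        have hlt : returnFunction V M₀ (c * i + d) < ((j + 1 : ℕ) : ℕ∞) := by
          rw [hν]; exact_mod_cast Nat.lt_succ_self j
        unfold returnFunction at hlt
        simp only [iInf_lt_iff] at hlt
        obtain ⟨k, hk, hkj⟩ := hlt
        have hkj' : k ≤ j := by
          have : k < j + 1 := by exact_mod_cast hkj
          omega
        exact fun P h1 h2 => (hk P h1 h2).trans (Submodule.smul_mono_left (algFiltration_mono V hkj'))
      have : returnFunction W N i ≤ ((b * (e + j) : ℕ) : ℕ∞) := by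
        refine iInf₂_le (b * (e + j)) fun P h1 h2 => ?_
        have h3 := hj P (h1.trans (h i)) h2
        refine he.trans ((Submodule.smul_mono le_rfl h3).trans ?_)
        rw [← Submodule.smul_assoc, smul_eq_mul]
        refine Submodule.smul_mono_left (le_trans ?_ (hb (e + j)))
        rw [algFiltration, algFiltration, algFiltration, pow_add]
      refine this.trans ?_
      norm_cast
      nlinarith [Nat.zero_le (b * e * j)]
  · exact le_iSup_of_le V (le_iSup₂_of_le hV hV' (le_iSup_of_le M₀ (le_iSup₂_of_le hM hM' le_rfl)))

end Independence

/-! Write B for the fixed algebra. The upper bound on `h_A` compares modules over A and over B. The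
key fact is that A = XB for some finite dimensional X containing 1. It comes from the skew group
ring A*G and its two-sided ideal I generated by the sum of the group elements. Simplicity of A gives
I a complement spanned over A by some of the group elements, and the projections of all g ∈ G onto I
yield identities which, summed over G, write |G|a as an element of XB (`exists_traceIdeal_sum_eq`,
`exists_fg_mul_fixedPoints_eq_top`). From A = XB, the filtration of A can be moved past X at the
cost of a filtration of B: A_i X ⊆ X B_i (`exists_algFiltration_mul_le`). With the Reynolds operator
τ this shows that B is finitely generated. It also shows that the induced A-module of a nonzero M,
which is nonzero because τ splits B off A, has growth at most dim X times that of M.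

The lower bound on `h_A` is Bavula's filter inequality. If a nonzero x ∈ A_i annihilated M_j with j
≥ ν(i), the return function would recover 1 from x by at most j left or right multiplications by
generators, and each of these shrinks the annihilated layer by at most one step, so 1 would
annihilate M_0. Hence A_i embeds in Hom(M_j, M_{i+j}). Comparing degrees with j close to i^fdim(A)
gives the factor fdim(A) + max{fdim(A), 1}. -/

/-! ### The skew group ring and finiteness over the fixed algebra -/

section FixedRing

/-- The additive subgroup of `G → A` generated by the functions `g ↦ x * g • y`. It is the two-sided
ideal of the skew group ring generated by the sum of the group elements. -/
def traceIdeal (G A : Type*) [Ring A] [Group G] [MulSemiringAction G A] : AddSubgroup (G → A) :=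
  AddSubgroup.closure {φ | ∃ x y : A, φ = fun g => x * g • y}

section

variable {G A : Type*} [Ring A] [Group G] [MulSemiringAction G A]

theorem mul_left_mem_traceIdeal {φ : G → A} (hφ : φ ∈ traceIdeal G A) (a : A) :
    (fun g => a * φ g) ∈ traceIdeal G A := by
  induction hφ using AddSubgroup.closure_induction with
  | mem φ h =>
    obtain ⟨x, y, rfl⟩ := h
    exact AddSubgroup.subset_closure ⟨a * x, y, by simp only [mul_assoc]⟩
  | zero => convert (traceIdeal G A).zero_mem; simp
  | add φ ψ _ _ h1 h2 => convert add_mem h1 h2; simp [mul_add]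
  | neg φ _ h => convert neg_mem h; simp

/-- With φ read as the element ∑ φ(g) g of the skew group ring, the rule g a = g(a) g makes right
multiplication by a act through g • a. -/
theorem mul_right_mem_traceIdeal {φ : G → A} (hφ : φ ∈ traceIdeal G A) (a : A) :
    (fun g => φ g * g • a) ∈ traceIdeal G A := by
  induction hφ using AddSubgroup.closure_induction with
  | mem φ h =>
    obtain ⟨x, y, rfl⟩ := h
    exact AddSubgroup.subset_closure ⟨x, y * a, by simp only [mul_assoc, smul_mul']⟩
  | zero => convert (traceIdeal G A).zero_mem; simp
  | add φ ψ _ _ h1 h2 => convert add_mem h1 h2; simp [add_mul]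
  | neg φ _ h => convert neg_mem h; simp

/-- The values at g of those elements of the trace ideal whose support lies in that of φ form a
two-sided ideal of A. It contains φ g ≠ 0, hence 1 by simplicity. -/
theorem exists_mem_traceIdeal_apply_eq_one [IsSimpleRing A] {φ : G → A}
    (hφ : φ ∈ traceIdeal G A) {g : G} (hg : φ g ≠ 0) :
    ∃ ψ ∈ traceIdeal G A, ψ g = 1 ∧ ∀ h, φ h = 0 → ψ h = 0 := by
  let J : TwoSidedIdeal A := TwoSidedIdeal.mk'
    {c | ∃ ψ ∈ traceIdeal G A, ψ g = c ∧ ∀ h, φ h = 0 → ψ h = 0}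
    ⟨0, zero_mem _, rfl, fun _ _ => rfl⟩
    (by
      rintro _ _ ⟨ψ, hψ, rfl, h1⟩ ⟨χ, hχ, rfl, h2⟩
      exact ⟨ψ + χ, add_mem hψ hχ, rfl, fun h hh => by simp [h1 h hh, h2 h hh]⟩)
    (by
      rintro _ ⟨ψ, hψ, rfl, h1⟩
      exact ⟨-ψ, neg_mem hψ, rfl, fun h hh => by simp [h1 h hh]⟩)
    (by
      rintro x _ ⟨ψ, hψ, rfl, h1⟩
      exact ⟨_, mul_left_mem_traceIdeal hψ x, rfl, fun h hh => by simp [h1 h hh]⟩)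
    (by
      rintro _ y ⟨ψ, hψ, rfl, h1⟩
      exact ⟨_, mul_right_mem_traceIdeal hψ (g⁻¹ • y), by simp, fun h hh => by simp [h1 h hh]⟩)
  have h1 : (1 : A) ∈ J := IsSimpleRing.one_mem_of_ne_zero_mem J hg
    (by rw [TwoSidedIdeal.mem_mk']; exact ⟨φ, hφ, rfl, fun _ h => h⟩)
  rwa [TwoSidedIdeal.mem_mk'] at h1

/-- The trace ideal of a simple ring is generated as a right ideal, up to a multiple `|G|`, by the
values of a bimodule projection onto it at the elements of `G`. -/
theorem exists_traceIdeal_sum_eq [IsSimpleRing A] [Fintype G] :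
    ∃ p : G → G → A, (∀ g, p g ∈ traceIdeal G A) ∧
      ∀ (a : A) (h : G), ∑ g, p g h * h • g⁻¹ • a = a := by
  classical
  -- S is a maximal set of group elements whose A-span meets the trace ideal only in zero. This span
  -- turns out to be a complement of the ideal.
  obtain ⟨S, hS⟩ := (Set.toFinite {S : Set G | ∀ φ ∈ traceIdeal G A,
    (∀ g ∉ S, φ g = 0) → φ = 0}).exists_maximal
    ⟨∅, fun φ _ h => funext fun g => h g (Set.notMem_empty g)⟩
  -- p is the projection of the group element g onto the trace ideal along the span of S. It is zero
  -- for g ∈ S; for g ∉ S, maximality gives a nonzero element of the ideal supported on S ∪ {g},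
  -- which is normalised to have value 1 at g.
  have hp : ∀ g, ∃ p ∈ traceIdeal G A, ∀ h ∉ S, p h = if h = g then 1 else 0 := by
    intro g
    by_cases hg : g ∈ S
    · exact ⟨0, zero_mem _, fun h hh => by
        rw [if_neg (by rintro rfl; exact hh hg)]; rfl⟩
    · have : ¬ ∀ φ ∈ traceIdeal G A, (∀ h ∉ insert g S, φ h = 0) → φ = 0 := fun h =>
        hg (hS.2 h (Set.subset_insert g S) (Set.mem_insert g S))
      push Not at this
      obtain ⟨φ, hφ, h1, h2⟩ := this
      have hφg : φ g ≠ 0 := fun h0 => h2 (hS.1 φ hφ fun h hh => by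
        by_cases e : h = g
        · rw [e, h0]
        · exact h1 h (by simp [e, hh]))
      obtain ⟨ψ, hψ, h3, h4⟩ := exists_mem_traceIdeal_apply_eq_one hφ hφg
      refine ⟨ψ, hψ, fun h hh => ?_⟩
      split_ifs with e
      · rw [e, h3]
      · exact h4 h (h1 h (by simp [e, hh]))
  choose p hpI hpS using hp
  refine ⟨p, hpI, fun a => ?_⟩
  have hψ : (∑ g, fun h => p g h * h • g⁻¹ • a) ∈ traceIdeal G A :=
    sum_mem fun g _ => mul_right_mem_traceIdeal (hpI g) (g⁻¹ • a)
  have hc : (fun _ => a) ∈ traceIdeal G A :=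
    AddSubgroup.subset_closure ⟨a, 1, by simp⟩
  -- Outside S only the term g = h survives, with value a, so the difference lies in the ideal and
  -- is supported on S. The choice of S forces it to vanish.
  have := hS.1 _ (sub_mem hψ hc) (fun h hh => by
    simp [hpS _ h hh])
  intro h
  have := congrFun this h
  simpa [sub_eq_zero] using this

end

variable {K A G : Type*} [Field K] [Ring A] [Algebra K A] [Group G] [MulSemiringAction G A]
  [SMulCommClass G K A]

theorem sum_smul_mem_fixedPoints [Fintype G] (a : A) :
    ∑ g : G, g • a ∈ FixedPoints.subalgebra K A G := by
  intro h
  rw [Finset.smul_sum]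
  simp only [smul_smul]
  exact Fintype.sum_equiv (Equiv.mulLeft h) _ _ fun _ => rfl

/-- A simple ring is a finitely generated right module over the ring of invariants of a finite group
whose order is invertible. -/
theorem exists_fg_mul_fixedPoints_eq_top [IsSimpleRing A] [Finite G]
    (hG : IsUnit ((Nat.card G : ℕ) : A)) :
    ∃ X : Submodule K A, X.FG ∧ 1 ≤ X ∧
      X * Subalgebra.toSubmodule (FixedPoints.subalgebra K A G) = ⊤ := by
  have := Fintype.ofFinite G
  let B := Subalgebra.toSubmodule (FixedPoints.subalgebra K A G)
  -- An element of A*G acts on A by a ↦ ∑ φ(h) h(a). A generator given by x and y acts as a ↦ x ·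
  -- tr(ya), with the trace in B, so X can be chosen independently of a.
  have key : ∀ φ ∈ traceIdeal G A, ∃ X : Submodule K A, X.FG ∧
      ∀ a, ∑ h, φ h * h • a ∈ X * B := by
    intro φ hφ
    induction hφ using AddSubgroup.closure_induction with
    | mem φ h =>
      obtain ⟨x, y, rfl⟩ := h
      refine ⟨Submodule.span K {x}, Submodule.fg_span_singleton x, fun a => ?_⟩
      simp only [mul_assoc, ← smul_mul', ← Finset.mul_sum]
      exact Submodule.mul_mem_mul (Submodule.mem_span_singleton_self x)
        (sum_smul_mem_fixedPoints (K := K) (y * a))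
    | zero => exact ⟨⊥, Submodule.fg_bot, fun a => by simp⟩
    | add φ ψ _ _ h1 h2 =>
      obtain ⟨X, hX, h1⟩ := h1
      obtain ⟨Y, hY, h2⟩ := h2
      refine ⟨X ⊔ Y, hX.sup hY, fun a => ?_⟩
      simp only [Pi.add_apply, add_mul, Finset.sum_add_distrib]
      exact add_mem (Submodule.smul_mono_left le_sup_left (h1 a))
        (Submodule.smul_mono_left le_sup_right (h2 a))
    | neg φ _ h =>
      obtain ⟨X, hX, h1⟩ := h
      refine ⟨X, hX, fun a => ?_⟩
      simp only [Pi.neg_apply, neg_mul, Finset.sum_neg_distrib]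
      exact neg_mem (h1 a)
  obtain ⟨p, hp, hsum⟩ := exists_traceIdeal_sum_eq (G := G) (A := A)
  choose X hX hXp using fun g => key (p g) (hp g)
  refine ⟨1 ⊔ ⨆ g, X g, Submodule.FG.sup
    (by rw [Submodule.one_eq_span]; exact Submodule.fg_span_singleton 1)
    (Submodule.fg_iSup _ hX), le_sup_left, ?_⟩
  rw [eq_top_iff]
  rintro a -
  obtain ⟨u, hu⟩ := hG
  -- Summing the identity over h produces |G| copies of its argument; the argument |G|⁻¹a
  -- compensates.
  have h1 : ∑ h : G, ∑ g, p g h * h • g⁻¹ • ((↑u⁻¹ : A) * a) = a := by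
    simp only [hsum, Finset.sum_const, Finset.card_univ, nsmul_eq_mul, ← Nat.card_eq_fintype_card]
    rw [← hu, Units.mul_inv_cancel_left]
  rw [← h1, Finset.sum_comm]
  exact sum_mem fun g _ => Submodule.smul_mono_left
    ((le_iSup X g).trans le_sup_right) (hXp g _)

/-- The Reynolds operator. -/
theorem exists_reynolds [Nontrivial A] [Finite G] (hG : IsUnit ((Nat.card G : ℕ) : A)) :
    ∃ τ : A →ₗ[K] FixedPoints.subalgebra K A G,
      (∀ (a : A) (b : FixedPoints.subalgebra K A G), τ (a * b) = τ a * b) ∧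
      τ 1 = 1 := by
  have := Fintype.ofFinite G
  have hn : ((Nat.card G : ℕ) : K) ≠ 0 := fun h => hG.ne_zero (by
    rw [← map_natCast (algebraMap K A), h, map_zero])
  let σ : A →ₗ[K] FixedPoints.subalgebra K A G :=
    { toFun := fun a => ⟨∑ g : G, g • a, sum_smul_mem_fixedPoints a⟩
      map_add' := fun a b => Subtype.ext (by simp [Finset.sum_add_distrib])
      map_smul' := fun k a => Subtype.ext (by simp [smul_comm _ k, Finset.smul_sum]) }
  refine ⟨((Nat.card G : ℕ) : K)⁻¹ • σ, fun a b => ?_, ?_⟩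
  · rw [LinearMap.smul_apply, LinearMap.smul_apply, smul_mul_assoc]
    congr 1
    refine Subtype.ext ?_
    simp [σ, Finset.sum_mul, show ∀ g : G, g • (b : A) = b from b.2]
  · rw [LinearMap.smul_apply, inv_smul_eq_iff₀ hn]
    refine Subtype.ext ?_
    simp [σ, Algebra.smul_def]

end FixedRing

/-! ### Passing between A and a subalgebra B with A = XB -/

section FiniteRightModule

theorem finrank_smul_le {K A M : Type*} [Field K] [Ring A] [Algebra K A] [AddCommGroup M]
    [Module K M] [Module A M] [IsScalarTower K A M] {X : Submodule K A} {N : Submodule K M}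
    (hX : X.FG) (hN : N.FG) :
    (X • N).FG ∧ Module.finrank K ↥(X • N) ≤ Module.finrank K X * Module.finrank K N := by
  have := Module.Finite.of_fg hX
  have := Module.Finite.of_fg hN
  let f : X ⊗[K] N →ₗ[K] M := TensorProduct.lift
    (((Algebra.lsmul K K M : A →ₐ[K] Module.End K M).toLinearMap.domRestrict₁₂ X N))
  have h : X • N = LinearMap.range f := by
    apply le_antisymm
    · exact Submodule.smul_le.2 fun a ha m hm => ⟨(⟨a, ha⟩ : X) ⊗ₜ (⟨m, hm⟩ : N), rfl⟩
    · rintro _ ⟨t, rfl⟩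
      induction t with
      | zero => simp
      | tmul a m => exact Submodule.smul_mem_smul a.2 m.2
      | add s t hs ht => rw [map_add]; exact add_mem hs ht
  rw [h]
  exact ⟨Module.Finite.iff_fg.1 inferInstance,
    (LinearMap.finrank_range_le f).trans (Module.finrank_tensorProduct).le⟩

variable {K A : Type*} [Field K] [Ring A] [Algebra K A] {B : Subalgebra K A}

theorem exists_fg_le_mul_map {X V : Submodule K A}
    (hXB : X * Subalgebra.toSubmodule B = ⊤) (hV : V.FG) :
    ∃ W : Submodule K B, W.FG ∧ V ≤ X * W.map B.val.toLinearMap := by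
  induction V, hV using Submodule.fg_induction with
  | singleton x =>
    have hx : x ∈ X * Subalgebra.toSubmodule B := by rw [hXB]; trivial
    suffices ∃ W : Submodule K B, W.FG ∧ x ∈ X * W.map B.val.toLinearMap by
      simpa only [Submodule.span_singleton_le_iff_mem] using this
    induction hx using Submodule.mul_induction_on' with
    | mem_mul_mem a ha b hb =>
      exact ⟨Submodule.span K {⟨b, hb⟩}, Submodule.fg_span_singleton _, Submodule.mul_mem_mul ha
        ⟨⟨b, hb⟩, Submodule.mem_span_singleton_self _, rfl⟩⟩
    | add a _ b _ h1 h2 =>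
      obtain ⟨W, hW, h1⟩ := h1
      obtain ⟨U, hU, h2⟩ := h2
      exact ⟨W ⊔ U, hW.sup hU, add_mem
        (Submodule.smul_mono le_rfl (Submodule.map_mono le_sup_left) h1)
        (Submodule.smul_mono le_rfl (Submodule.map_mono le_sup_right) h2)⟩
  | sup N P _ _ hN hP =>
    obtain ⟨W, hW, h1⟩ := hN
    obtain ⟨U, hU, h2⟩ := hP
    exact ⟨W ⊔ U, hW.sup hU, sup_le
      (h1.trans (Submodule.smul_mono le_rfl (Submodule.map_mono le_sup_left)))
      (h2.trans (Submodule.smul_mono le_rfl (Submodule.map_mono le_sup_right)))⟩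

/-- Finite dimensionality of VX puts it inside XW for a single finite dimensional W ⊆ B. Iterating
(K + V)X ⊆ X(K + W) moves X across one factor at a time. -/
theorem exists_algFiltration_mul_le {X V : Submodule K A} (hX : X.FG)
    (hXB : X * Subalgebra.toSubmodule B = ⊤) (hV : V.FG) :
    ∃ W : Submodule K B, W.FG ∧ ∀ i,
      algFiltration V i * X ≤ X * (algFiltration W i).map B.val.toLinearMap := by
  obtain ⟨W, hW, h⟩ := exists_fg_le_mul_map hXB (hV.mul hX)
  refine ⟨W, hW, fun i => ?_⟩
  have h1 : (1 ⊔ V) * X ≤ X * (1 ⊔ W).map B.val.toLinearMap := by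
    rw [Submodule.sup_mul, Submodule.map_sup, Submodule.mul_sup]
    refine sup_le (le_sup_of_le_left ?_) (le_sup_of_le_right h)
    rw [Submodule.map_one, one_mul, mul_one]
  induction i with
  | zero => simp only [algFiltration, pow_zero, Submodule.map_one, one_mul, mul_one, le_refl]
  | succ i ih =>
    simp only [algFiltration, Submodule.map_pow] at ih ⊢
    rw [pow_succ, mul_assoc, pow_succ, ← mul_assoc X]
    refine (Submodule.smul_mono le_rfl h1).trans ?_
    rw [smul_eq_mul, ← mul_assoc]
    exact Submodule.smul_mono_left ih

theorem exists_fg_adjoin_eq_top (K A : Type*) [Field K] [Ring A] [Algebra K A]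
    [Algebra.FiniteType K A] :
    ∃ V : Submodule K A, V.FG ∧ Algebra.adjoin K (V : Set A) = ⊤ := by
  obtain ⟨s, hs⟩ := Algebra.FiniteType.out (R := K) (A := A)
  exact ⟨Submodule.span K s, ⟨s, rfl⟩, by rw [Algebra.adjoin_span, hs]⟩

/-- If `A` is a finitely generated algebra and a finitely generated right module over a subalgebra
`B` that is a direct summand of `A` as a right module, then `B` is finitely generated. -/
theorem finiteType_of_mul_eq_top [Algebra.FiniteType K A] {X : Submodule K A} (hX : X.FG)
    (hX1 : 1 ≤ X) (hXB : X * Subalgebra.toSubmodule B = ⊤) (τ : A →ₗ[K] B)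
    (hτ : ∀ (a : A) (b : B), τ (a * b) = τ a * b) (hτ1 : τ 1 = 1) :
    Algebra.FiniteType K B := by
  obtain ⟨V, hV, hV'⟩ := exists_fg_adjoin_eq_top K A
  obtain ⟨W, hW, hWX⟩ := exists_algFiltration_mul_le hX hXB hV
  -- Generators of B: if b ∈ B lies in A_i, then b = b · 1 ∈ A_i X ⊆ X B_i, and therefore b = τ(b) ∈
  -- τ(X) B_i.
  obtain ⟨s, hs⟩ := hW.sup (hX.map τ)
  refine ⟨⟨s, ?_⟩⟩
  rw [← Algebra.adjoin_span, hs, eq_top_iff]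
  rintro b -
  set C := Algebra.adjoin K ((W ⊔ X.map τ : Submodule K B) : Set B) with hC
  have hsub : W ⊔ X.map τ ≤ Subalgebra.toSubmodule C := Algebra.subset_adjoin
  have hWC : ∀ i, algFiltration W i ≤ Subalgebra.toSubmodule C := fun i => by
    have h1 : 1 ⊔ W ≤ Subalgebra.toSubmodule C :=
      sup_le (Submodule.one_le.2 C.one_mem) (le_sup_left.trans hsub)
    rw [algFiltration]
    induction i with
    | zero => rw [pow_zero]; exact le_sup_left.trans h1
    | succ i ih =>
      rw [pow_succ]
      exact Submodule.mul_le.2 fun x hx y hy => C.mul_mem (ih hx) (h1 hy)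
  obtain ⟨i, hi⟩ := mem_algFiltration hV' (b : A)
  have hb : (b : A) ∈ X * (algFiltration W i).map B.val.toLinearMap := by
    rw [← mul_one (b : A)]
    exact hWX i (Submodule.mul_mem_mul hi (Submodule.one_le.1 hX1))
  have hle : X * (algFiltration W i).map B.val.toLinearMap ≤
      (Subalgebra.toSubmodule C).comap τ := by
    refine Submodule.mul_le.2 ?_
    rintro x hx _ ⟨y, hy, rfl⟩
    change τ (x * (y : A)) ∈ C
    rw [hτ]
    exact C.mul_mem (hsub (Submodule.mem_sup_right ⟨x, hx, rfl⟩)) (hWC i hy)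
  have h2 : τ (b : A) ∈ C := hle hb
  rwa [← one_mul (b : A), hτ, hτ1, one_mul] at h2

/-- An `A`-module that is generated by the image of a `B`-module does not grow faster, if `A` is a
finitely generated right `B`-module. -/
theorem modGKDim_le_of_span_range_eq_top [Algebra.FiniteType K A] {X : Submodule K A} (hX : X.FG)
    (hX1 : 1 ≤ X) (hXB : X * Subalgebra.toSubmodule B = ⊤)
    {M N : Type*} [AddCommGroup M] [Module K M] [Module B M] [IsScalarTower K B M]
    [Module.Finite B M] [AddCommGroup N] [Module K N] [Module A N] [IsScalarTower K A N]
    (ι : M →ₗ[B] N) (hι : Submodule.span A (Set.range ι) = ⊤) :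
    modGKDim K A N ≤ modGKDim K B M := by
  obtain ⟨V, hV, hV'⟩ := exists_fg_adjoin_eq_top K A
  obtain ⟨W, hW, hWX⟩ := exists_algFiltration_mul_le hX hXB hV
  obtain ⟨s, hs⟩ := Module.Finite.fg_top (R := B) (M := M)
  let M₀ : Submodule K M := Submodule.span K s
  have hM : M₀.FG := ⟨s, rfl⟩
  let ιK : M →ₗ[K] N := ι.restrictScalars K
  have hN' : Submodule.span A ((M₀.map ιK : Submodule K N) : Set N) = ⊤ := by
    rw [eq_top_iff, ← hι, Submodule.span_le]
    rintro _ ⟨m, rfl⟩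
    have hm : m ∈ Submodule.span B (s : Set M) := by rw [hs]; trivial
    induction hm using Submodule.span_induction with
    | mem x hx => exact Submodule.subset_span ⟨x, Submodule.subset_span hx, rfl⟩
    | zero => rw [map_zero]; exact zero_mem _
    | add x y _ _ hx hy => rw [map_add]; exact add_mem hx hy
    | smul b x _ hx => rw [map_smul]; exact Submodule.smul_mem _ (b : A) hx
  rw [modGKDim_eq hV hV' (hM.map ιK) hN']
  -- W need not generate B: the dimension of M is a supremum over all finite dimensional subspaces.
  refine le_trans ?_ (le_iSup₂_of_le W hW (le_iSup₂_of_le M₀ hM le_rfl))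
  refine growthDegree_le_of_le (Module.finrank K X) 1 0 (fun i => ?_) le_rfl
  have hle : modFiltration V (M₀.map ιK) i ≤ X • (modFiltration W M₀ i).map ιK := by
    calc algFiltration V i • M₀.map ιK
        ≤ (algFiltration V i * X) • M₀.map ιK := Submodule.smul_mono_left (by
          conv_lhs => rw [← mul_one (algFiltration V i)]
          exact Submodule.smul_mono le_rfl hX1)
      _ ≤ (X * (algFiltration W i).map B.val.toLinearMap) • M₀.map ιK :=
          Submodule.smul_mono_left (hWX i)
      _ = X • (algFiltration W i).map B.val.toLinearMap • M₀.map ιK := by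
          rw [← smul_eq_mul, Submodule.smul_assoc]
      _ ≤ X • (modFiltration W M₀ i).map ιK := by
          refine Submodule.smul_mono le_rfl (Submodule.smul_le.2 ?_)
          rintro _ ⟨b, hb, rfl⟩ _ ⟨m, hm, rfl⟩
          exact ⟨b • m, Submodule.smul_mem_smul hb hm, ι.map_smul b m⟩
  have hfg := modFiltration_fg hW hM i
  obtain ⟨h1, h2⟩ := finrank_smul_le hX (hfg.map ιK)
  have := Module.Finite.of_fg h1
  have := Module.Finite.of_fg hfg
  have h3 := (Submodule.finrank_mono hle).trans (h2.trans
    (Nat.mul_le_mul_left _ (Submodule.finrank_map_le ιK (modFiltration W M₀ i))))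
  rw [one_mul, add_zero]
  refine le_trans ?_ le_self_add
  exact_mod_cast h3

/-- The module `A ⊗ M` induced from a finitely generated module over a subalgebra `B` that is a
direct summand of the right `B`-module `A`. -/
theorem exists_induced_module {K : Type*} {A : Type u} [Field K] [Ring A] [Algebra K A]
    {B : Subalgebra K A} (τ : A →ₗ[K] B) (hτ : ∀ (a : A) (b : B), τ (a * b) = τ a * b)
    (hτ1 : τ 1 = 1)
    (M : Type*) [AddCommGroup M] [Module B M] [Nontrivial M] [Module.Finite B M] :
    ∃ (N : Type u) (_ : AddCommGroup N) (_ : Module K N) (_ : Module A N)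
      (_ : IsScalarTower K A N) (ι : M →ₗ[B] N), Nontrivial N ∧ Module.Finite A N ∧
      Submodule.span A (Set.range ι) = ⊤ := by
  obtain ⟨n, f, hf⟩ := Module.Finite.exists_fin' B M
  let L := LinearMap.ker f
  let j : (Fin n → B) →ₗ[B] (Fin n → A) :=
    { toFun := fun v k => v k
      map_add' := fun v w => rfl
      map_smul' := fun b v => rfl }
  -- For M = B^n / L the induced module is A^n / AL. This presentation keeps it in the universe of
  -- A, as `holonomicNumber` requires, whatever the universe of M.
  let P : Submodule A (Fin n → A) := Submodule.span A (j '' L)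
  let g : (Fin n → B) →ₗ[B] (Fin n → A) ⧸ P := (P.mkQ.restrictScalars B) ∘ₗ j
  have hg : L ≤ LinearMap.ker g := fun v hv => by
    rw [LinearMap.mem_ker]
    exact (Submodule.Quotient.mk_eq_zero P).2 (Submodule.subset_span ⟨v, hv, rfl⟩)
  let ι : M →ₗ[B] (Fin n → A) ⧸ P := (L.liftQ g hg) ∘ₗ (f.quotKerEquivOfSurjective hf).symm
  have hι : ∀ v, ι (f v) = P.mkQ (j v) := fun v => by
    have : (f.quotKerEquivOfSurjective hf).symm (f v) = L.mkQ v := by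
      rw [LinearEquiv.symm_apply_eq]; rfl
    simp only [ι, LinearMap.comp_apply, LinearEquiv.coe_coe, this]
    rfl
  -- Coordinatewise τ maps AL back into L, by right B-linearity. The extra factor a lets the
  -- induction pass through scalar multiplication, since τ is not left A-linear.
  have hP : ∀ v ∈ P, ∀ a : A, (fun k => τ (a * v k)) ∈ L := by
    intro v hv
    induction hv using Submodule.span_induction with
    | mem x hx =>
      obtain ⟨y, hy, rfl⟩ := hx
      intro a
      convert L.smul_mem (τ a) hy using 1
      exact funext fun k => hτ a (y k)
    | zero =>
      intro a
      convert L.zero_mem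
      simp
    | add x y _ _ hx hy =>
      intro a
      convert L.add_mem (hx a) (hy a)
      simp [mul_add]
    | smul b x _ hx =>
      intro a
      convert hx (a * b) using 3
      simp [mul_assoc]
  refine ⟨(Fin n → A) ⧸ P, inferInstance, inferInstance, inferInstance, inferInstance, ι, ?_,
    inferInstance, ?_⟩
  · rw [Submodule.Quotient.nontrivial_iff]
    intro htop
    obtain ⟨m, hm⟩ := exists_ne (0 : M)
    obtain ⟨v, rfl⟩ := hf m
    refine hm ?_
    -- If AL were all of A^n, then τ, being the identity on B, would put every v ∈ B^n into L, and M
    -- would be zero.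
    have hv := hP (j v) (htop ▸ Submodule.mem_top) 1
    have : (fun k => τ (1 * j v k)) = v := funext fun k =>
      (hτ 1 (v k)).trans (by rw [hτ1, one_mul])
    rwa [this] at hv
  · rw [eq_top_iff]
    rintro x -
    obtain ⟨w, rfl⟩ := P.mkQ_surjective x
    have hw : w = ∑ k, w k • j (Pi.single k 1) := by
      ext l
      rw [Finset.sum_apply, Finset.sum_eq_single l]
      · simp [j]
      · intro k _ hk
        simp [j, Pi.single_eq_of_ne hk.symm]
      · simp
    rw [hw, map_sum]
    refine sum_mem fun k _ => ?_
    rw [map_smul, ← hι]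
    exact Submodule.smul_mem _ _ (Submodule.subset_span ⟨_, rfl⟩)

end FiniteRightModule

/-! ### Growth estimates and the filter inequality -/

section FilterInequality

theorem eventually_le_of_growthDegree_lt {f : ℕ → ℕ∞} {r : ℝ≥0} (h : growthDegree f < r) :
    ∀ᶠ i : ℕ in atTop, ((f i : ℕ∞) : ℝ≥0∞) ≤ (i : ℝ≥0∞) ^ (r : ℝ) := by
  simp only [growthDegree, iInf_lt_iff] at h
  obtain ⟨s, hs, hsr⟩ := h
  filter_upwards [hs, eventually_ge_atTop 1] with i h1 h2
  exact h1.trans (ENNReal.rpow_le_rpow_of_exponent_le (by exact_mod_cast h2)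
    (by exact_mod_cast hsr.le))

/-- The degree of a function bounded by a product of values of `g`, evaluated at any
bound for `ν`. -/
theorem growthDegree_le_mul_of_le_mul_add {f : ℕ → ℕ∞} {g : ℕ → ℕ} {ν : ℕ → ℕ∞}
    (hf : ∀ i j : ℕ, ν i ≤ j → f i ≤ ((g j * g (j + i) : ℕ) : ℕ∞)) {r s : ℝ≥0}
    (hr : growthDegree (fun i => (g i : ℕ∞)) < r) (hs : growthDegree ν < s) :
    growthDegree f ≤ (r * (s + max s 1) : ℝ≥0) := by
  have hs0 : 0 < (s : ℝ) := by
    exact_mod_cast pos_of_gt hs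
  refine ENNReal.le_of_forall_pos_le_add fun ε hε _ => ?_
  rw [← ENNReal.coe_add]
  refine iInf₂_le (r * (s + max s 1) + ε) ?_
  -- The choice j = ⌊i^s⌋ eventually bounds ν(i). It tends to infinity because s > 0, so the
  -- asymptotic bound on g applies at j and at j + i ≤ 2 i^max(s,1); the constant 2^r is absorbed by
  -- i^ε.
  have ht : Tendsto (fun i : ℕ => ⌊(i : ℝ) ^ (s : ℝ)⌋₊) atTop atTop :=
    tendsto_nat_floor_atTop.comp ((tendsto_rpow_atTop hs0).comp tendsto_natCast_atTop_atTop)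
  have hlim : Tendsto (fun i : ℕ => (i : ℝ) ^ (ε : ℝ)) atTop atTop :=
    (tendsto_rpow_atTop (by exact_mod_cast hε)).comp tendsto_natCast_atTop_atTop
  have hgr := eventually_le_of_growthDegree_lt hr
  filter_upwards [ht.eventually hgr,
    (tendsto_atTop_mono (fun i => Nat.le_add_right _ i) ht).eventually hgr,
    eventually_le_of_growthDegree_lt hs, eventually_ge_atTop 1,
    hlim.eventually_ge_atTop ((2 : ℝ) ^ (r : ℝ))] with i h1 h2 h3 h4 h5
  set j := ⌊(i : ℝ) ^ (s : ℝ)⌋₊ with hj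
  have hi1 : (1 : ℝ) ≤ i := by exact_mod_cast h4
  have hjs : (j : ℝ) ≤ (i : ℝ) ^ (s : ℝ) := Nat.floor_le (by positivity)
  have toReal : ∀ (a b : ℕ) (t : ℝ≥0), ((a : ℕ∞) : ℝ≥0∞) ≤ (b : ℝ≥0∞) ^ (t : ℝ) ↔
      (a : ℝ) ≤ (b : ℝ) ^ (t : ℝ) := by
    intro a b t
    have e1 : ((a : ℕ∞) : ℝ≥0∞) = ((a : ℝ≥0) : ℝ≥0∞) := by simp
    have e2 : (b : ℝ≥0∞) ^ (t : ℝ) = (((b : ℝ≥0) ^ (t : ℝ) : ℝ≥0) : ℝ≥0∞) := by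
      rw [ENNReal.coe_rpow_of_nonneg _ (NNReal.coe_nonneg t)]; simp
    rw [e1, e2, ENNReal.coe_le_coe, ← NNReal.coe_le_coe]
    simp
  have hν : ν i ≤ j := by
    cases hk : ν i with
    | top =>
      rw [hk] at h3
      exact absurd (top_le_iff.1 h3) (ENNReal.rpow_ne_top_of_nonneg s.2 (ENNReal.natCast_ne_top i))
    | coe k =>
      rw [hk, toReal] at h3
      exact_mod_cast Nat.le_floor h3
  refine (ENat.toENNReal_mono (hf i j hν)).trans ?_
  rw [toReal] at h1 h2 ⊢
  push_cast at h1 h2 ⊢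
  have hm : (i : ℝ) ^ (s : ℝ) ≤ (i : ℝ) ^ (max (s : ℝ) 1) :=
    Real.rpow_le_rpow_of_exponent_le hi1 (le_max_left _ _)
  have hm' : (i : ℝ) ≤ (i : ℝ) ^ (max (s : ℝ) 1) := by
    conv_lhs => rw [← Real.rpow_one (i : ℝ)]
    exact Real.rpow_le_rpow_of_exponent_le hi1 (le_max_right _ _)
  calc (g j : ℝ) * g (j + i) ≤ (j : ℝ) ^ (r : ℝ) * (j + i : ℝ) ^ (r : ℝ) := by gcongr
    _ ≤ ((i : ℝ) ^ (s : ℝ)) ^ (r : ℝ) * (2 * (i : ℝ) ^ (max (s : ℝ) 1)) ^ (r : ℝ) := by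
      gcongr
      linarith
    _ = (2 : ℝ) ^ (r : ℝ) * (i : ℝ) ^ ((r : ℝ) * (s + max (s : ℝ) 1)) := by
      rw [Real.mul_rpow (by positivity) (by positivity), ← Real.rpow_mul (by positivity),
        ← Real.rpow_mul (by positivity), mul_left_comm, ← Real.rpow_add (by positivity)]
      ring_nf
    _ ≤ (i : ℝ) ^ (ε : ℝ) * (i : ℝ) ^ ((r : ℝ) * (s + max (s : ℝ) 1)) := by gcongr
    _ = _ := by rw [← Real.rpow_add (by positivity), add_comm]

variable {K A M : Type*} [Field K] [Ring A] [Algebra K A] [AddCommGroup M] [Module K M]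
  [Module A M] [IsScalarTower K A M]

/-- The elements of `A` that annihilate `N`. -/
def annihilatorSubmodule (K : Type*) {A M : Type*} [Field K] [Ring A] [Algebra K A] [AddCommGroup M]
    [Module K M] [Module A M] [IsScalarTower K A M] (N : Submodule K M) : Submodule K A where
  carrier := {x | ∀ m ∈ N, x • m = 0}
  add_mem' hx hy m hm := by rw [add_smul, hx m hm, hy m hm, add_zero]
  zero_mem' m _ := zero_smul A m
  smul_mem' k x hx m hm := by rw [smul_assoc, hx m hm, smul_zero]

/-- The generating subspace `V ⊗ 1 + 1 ⊗ V` of the enveloping algebra. -/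
def envelopingSubspace (V : Submodule K A) : Submodule K (A ⊗[K] Aᵐᵒᵖ) :=
  V.map (Algebra.TensorProduct.includeLeft : A →ₐ[K] A ⊗[K] Aᵐᵒᵖ).toLinearMap ⊔
    (V.map (MulOpposite.opLinearEquiv K).toLinearMap).map
      (Algebra.TensorProduct.includeRight : Aᵐᵒᵖ →ₐ[K] A ⊗[K] Aᵐᵒᵖ).toLinearMap

theorem envelopingSubspace_fg {V : Submodule K A} (hV : V.FG) : (envelopingSubspace V).FG :=
  (hV.map _).sup ((hV.map _).map _)

theorem adjoin_envelopingSubspace {V : Submodule K A} (hV : Algebra.adjoin K (V : Set A) = ⊤) :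
    Algebra.adjoin K (envelopingSubspace V : Set (A ⊗[K] Aᵐᵒᵖ)) = ⊤ := by
  set C := Algebra.adjoin K (envelopingSubspace V : Set (A ⊗[K] Aᵐᵒᵖ)) with hC
  have hl : ∀ a : A, a ⊗ₜ[K] (1 : Aᵐᵒᵖ) ∈ C := by
    intro a
    have ha : a ∈ Algebra.adjoin K (V : Set A) := by rw [hV]; trivial
    induction ha using Algebra.adjoin_induction with
    | mem x hx => exact Algebra.subset_adjoin (Submodule.mem_sup_left ⟨x, hx, rfl⟩)
    | algebraMap r => exact C.algebraMap_mem r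
    | add x y _ _ hx hy => rw [TensorProduct.add_tmul]; exact C.add_mem hx hy
    | mul x y _ _ hx hy => simpa using C.mul_mem hx hy
  have hr : ∀ a : A, (1 : A) ⊗ₜ[K] MulOpposite.op a ∈ C := by
    intro a
    have ha : a ∈ Algebra.adjoin K (V : Set A) := by rw [hV]; trivial
    induction ha using Algebra.adjoin_induction with
    | mem x hx => exact Algebra.subset_adjoin (Submodule.mem_sup_right ⟨_, ⟨x, hx, rfl⟩, rfl⟩)
    | algebraMap r =>
      convert C.algebraMap_mem r using 1
      rw [Algebra.TensorProduct.algebraMap_apply']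
      rfl
    | add x y _ _ hx hy => rw [MulOpposite.op_add, TensorProduct.tmul_add]; exact C.add_mem hx hy
    | mul x y _ _ hx hy => simpa using C.mul_mem hy hx
  rw [eq_top_iff, ← Algebra.TensorProduct.adjoin_tmul_eq_top, Algebra.adjoin_le_iff]
  rintro _ ⟨a, b, rfl⟩
  simpa using C.mul_mem (hl a) (hr b.unop)

section

attribute [local instance] envelopingModule envelopingModule_isScalarTower

theorem algFiltration_le_modFiltration_envelopingSubspace (V : Submodule K A) (i : ℕ) :
    algFiltration V i ≤ modFiltration (envelopingSubspace V) (1 : Submodule K A) i := by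
  have h : (algFiltration V i).map
      (Algebra.TensorProduct.includeLeft : A →ₐ[K] A ⊗[K] Aᵐᵒᵖ).toLinearMap ≤
      algFiltration (envelopingSubspace V) i := by
    rw [algFiltration, algFiltration, Submodule.map_pow, Submodule.map_sup, Submodule.map_one]
    exact pow_le_pow_left' (sup_le_sup_left le_sup_left _) i
  intro a ha
  have := Submodule.smul_mem_smul (h ⟨a, ha, rfl⟩) (Submodule.one_le.1 (le_refl (1 : Submodule K A)))
  have h1 : (a ⊗ₜ[K] (1 : Aᵐᵒᵖ)) • (1 : A) = a := by
    rw [envelopingModule_tmul_smul]; simp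
  exact h1 ▸ this

/-- Left multiplication preserves annihilation. Right multiplication by v ∈ V costs one step,
because x v M_k ⊆ x M_{k+1}. -/
theorem algFiltration_envelopingSubspace_smul_annihilator_le (V : Submodule K A)
    (M₀ : Submodule K M) (j k : ℕ) :
    algFiltration (envelopingSubspace V) j • annihilatorSubmodule K (A := A) (modFiltration V M₀ (j + k)) ≤
      annihilatorSubmodule K (A := A) (modFiltration V M₀ k) := by
  induction j generalizing k with
  | zero => rw [algFiltration, pow_zero, Submodule.one_smul, zero_add]
  | succ j ih =>
    have hmono : ∀ k, modFiltration V M₀ k ≤ modFiltration V M₀ (k + 1) := fun k =>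
      Submodule.smul_mono_left (algFiltration_mono V k.le_succ)
    have h1 : (1 ⊔ envelopingSubspace V) • annihilatorSubmodule K (A := A) (modFiltration V M₀ (k + 1)) ≤
        annihilatorSubmodule K (A := A) (modFiltration V M₀ k) := by
      rw [Submodule.sup_smul, Submodule.one_smul, envelopingSubspace, Submodule.sup_smul]
      refine sup_le (fun x hx m hm => hx m (hmono k hm)) (sup_le ?_ ?_)
      · refine Submodule.smul_le.2 ?_
        rintro _ ⟨v, hv, rfl⟩ x hx m hm
        have : (v ⊗ₜ[K] (1 : Aᵐᵒᵖ)) • x = v * x := by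
          rw [envelopingModule_tmul_smul]; simp
        change ((v ⊗ₜ[K] (1 : Aᵐᵒᵖ)) • x) • m = 0
        rw [this, mul_smul, hx m (hmono k hm), smul_zero]
      · refine Submodule.smul_le.2 ?_
        rintro _ ⟨_, ⟨v, hv, rfl⟩, rfl⟩ x hx m hm
        have : ((1 : A) ⊗ₜ[K] MulOpposite.op v) • x = x * v := by
          rw [envelopingModule_tmul_smul]; simp
        change (((1 : A) ⊗ₜ[K] MulOpposite.op v) • x) • m = 0
        rw [this, mul_smul]
        refine hx _ ?_
        rw [modFiltration, algFiltration, pow_succ', ← smul_eq_mul, Submodule.smul_assoc]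
        exact Submodule.smul_mem_smul (Submodule.mem_sup_right hv) hm
    rw [algFiltration, pow_succ', ← smul_eq_mul, Submodule.smul_assoc]
    refine (Submodule.smul_mono le_rfl ?_).trans h1
    have := ih (k + 1)
    rwa [show j + (k + 1) = j + 1 + k by ring] at this

/-- A nonzero x generates the simple ring A as a bimodule, so the return function recovers 1 from x
within j steps. If x killed M_j, then 1 would kill M_0. -/
theorem algFiltration_disjoint_annihilator [IsSimpleRing A] {V : Submodule K A} {M₀ : Submodule K M}
    (hM : M₀ ≠ ⊥) {i j : ℕ}
    (hj : returnFunction (envelopingSubspace V) (1 : Submodule K A) i ≤ j) {x : A}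
    (hx : x ∈ algFiltration V i) (hxM : ∀ m ∈ modFiltration V M₀ j, x • m = 0) : x = 0 := by
  by_contra hx0
  -- Strict comparison with j + 1 extracts from the infimum an admissible l ≤ j.
  have hlt : returnFunction (envelopingSubspace V) (1 : Submodule K A) i < ((j + 1 : ℕ) : ℕ∞) :=
    hj.trans_lt (by exact_mod_cast Nat.lt_succ_self j)
  unfold returnFunction at hlt
  simp only [iInf_lt_iff] at hlt
  obtain ⟨l, hl, hlj⟩ := hlt
  have hlj' : l ≤ j := Nat.lt_succ_iff.1 (by exact_mod_cast hlj)
  have hspan : Submodule.span (A ⊗[K] Aᵐᵒᵖ) ((Submodule.span K {x} : Submodule K A) : Set A) = ⊤ := by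
    set Q := Submodule.span (A ⊗[K] Aᵐᵒᵖ) ((Submodule.span K {x} : Submodule K A) : Set A)
    have hQ : ∀ a y b : A, y ∈ Q → a * y * b ∈ Q := fun a y b hy => by
      have := Q.smul_mem (a ⊗ₜ[K] MulOpposite.op b) hy
      rwa [envelopingModule_tmul_smul] at this
    let J : TwoSidedIdeal A := TwoSidedIdeal.mk' (Q : Set A) Q.zero_mem Q.add_mem Q.neg_mem
      (fun {a y} hy => by simpa using hQ a y 1 hy) (fun {y b} hy => by simpa using hQ 1 y b hy)
    have h1 : (1 : A) ∈ J := IsSimpleRing.one_mem_of_ne_zero_mem J hx0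
      (by rw [TwoSidedIdeal.mem_mk']; exact Submodule.subset_span
            (Submodule.mem_span_singleton_self x))
    rw [TwoSidedIdeal.mem_mk'] at h1
    exact eq_top_iff.2 fun a _ => by simpa using hQ a 1 1 h1
  have h1 := hl (Submodule.span K {x})
    (((Submodule.span_singleton_le_iff_mem _ _).2 hx).trans
      (algFiltration_le_modFiltration_envelopingSubspace V i)) hspan
  have h2 : Submodule.span K {x} ≤ annihilatorSubmodule K (A := A) (modFiltration V M₀ (l + 0)) := by
    rw [Submodule.span_singleton_le_iff_mem]
    exact fun m hm => hxM m (Submodule.smul_mono_left (algFiltration_mono V hlj') hm)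
  have h3 := algFiltration_envelopingSubspace_smul_annihilator_le V M₀ l 0
    (Submodule.smul_mono le_rfl h2 (h1 (Submodule.one_le.1 le_rfl)))
  refine hM (eq_bot_iff.2 fun m hm => ?_)
  have := h3 m (by rwa [modFiltration, algFiltration, pow_zero, Submodule.one_smul])
  simpa using this

theorem growthDegree_returnFunction_le_algFilterDim {V : Submodule K A} (hV : V.FG)
    (hV' : Algebra.adjoin K (V : Set A) = ⊤) :
    growthDegree (returnFunction (envelopingSubspace V) (1 : Submodule K A)) ≤
      algFilterDim K A := by
  refine le_iSup_of_le (envelopingSubspace V) (le_iSup₂_of_le (envelopingSubspace_fg hV)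
    (adjoin_envelopingSubspace hV') (le_iSup_of_le 1 (le_iSup₂_of_le
      (by rw [Submodule.one_eq_span]; exact Submodule.fg_span_singleton 1) ?_ le_rfl)))
  rw [eq_top_iff]
  intro a _
  have := Submodule.smul_mem (Submodule.span (A ⊗[K] Aᵐᵒᵖ) ((1 : Submodule K A) : Set A))
    (a ⊗ₜ[K] (1 : Aᵐᵒᵖ)) (Submodule.subset_span (Submodule.one_le.1 (le_refl (1 : Submodule K A))))
  simpa [envelopingModule_tmul_smul] using this

/-- The action of A_i embeds it into Hom(M_j, M_{j+i}), since no nonzero element of A_i annihilates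
M_j. -/
theorem finrank_algFiltration_le [IsSimpleRing A] {V : Submodule K A} {M₀ : Submodule K M}
    (hV : V.FG) (hM₀ : M₀.FG) (hM : M₀ ≠ ⊥) {i j : ℕ}
    (hj : returnFunction (envelopingSubspace V) (1 : Submodule K A) i ≤ j) :
    Module.finrank K (algFiltration V i) ≤ Module.finrank K (modFiltration V M₀ j) *
      Module.finrank K (modFiltration V M₀ (j + i)) := by
  have := Module.Finite.of_fg (modFiltration_fg hV hM₀ j)
  have := Module.Finite.of_fg (modFiltration_fg hV hM₀ (j + i))
  have hmem : ∀ (x : algFiltration V i) (m : modFiltration V M₀ j),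
      (x : A) • (m : M) ∈ modFiltration V M₀ (j + i) := fun x m => by
    rw [modFiltration, algFiltration, add_comm j i, pow_add, ← smul_eq_mul, Submodule.smul_assoc]
    exact Submodule.smul_mem_smul x.2 m.2
  let φ : algFiltration V i →ₗ[K] modFiltration V M₀ j →ₗ[K] modFiltration V M₀ (j + i) :=
    LinearMap.mk₂ K (fun x m => ⟨(x : A) • (m : M), hmem x m⟩)
      (fun x y m => Subtype.ext (add_smul (x : A) (y : A) (m : M)))
      (fun k x m => Subtype.ext (smul_assoc k (x : A) (m : M)))
      (fun x m n => Subtype.ext (smul_add (x : A) (m : M) (n : M)))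
      (fun k x m => Subtype.ext (smul_comm (x : A) k (m : M)))
  rw [← Module.finrank_linearMap K K]
  refine LinearMap.finrank_le_finrank_of_injective (f := φ) ?_
  rw [← LinearMap.ker_eq_bot, LinearMap.ker_eq_bot']
  intro x hx
  refine Subtype.ext (algFiltration_disjoint_annihilator hM hj x.2 fun m hm => ?_)
  exact congrArg Subtype.val (LinearMap.congr_fun hx ⟨m, hm⟩)

/-- Bavula's filter inequality. -/
theorem algGKDim_le_modGKDim_mul [IsSimpleRing A] [Algebra.FiniteType K A] [Nontrivial M]
    [Module.Finite A M] (hd : algFilterDim K A ≠ ⊤) :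
    algGKDim K A ≤ modGKDim K A M * (algFilterDim K A + max (algFilterDim K A) 1) := by
  obtain ⟨V, hV, hV'⟩ := exists_fg_adjoin_eq_top K A
  obtain ⟨s, hs⟩ := Module.Finite.fg_top (R := A) (M := M)
  let M₀ : Submodule K M := Submodule.span K s
  have hM₀ : M₀.FG := ⟨s, rfl⟩
  have hM₀' : Submodule.span A (M₀ : Set M) = ⊤ := by
    rw [eq_top_iff, ← hs]
    exact Submodule.span_mono Submodule.subset_span
  have hbot : M₀ ≠ ⊥ := fun h => by
    rw [h, Submodule.bot_coe, Submodule.span_zero_singleton] at hM₀'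
    exact bot_ne_top hM₀'
  have hD : algFilterDim K A + max (algFilterDim K A) 1 ≠ 0 := by simp
  rw [algGKDim_eq hV hV', modGKDim_eq hV hV' hM₀ hM₀']
  set γ := growthDegree fun i => (Module.finrank K (modFiltration V M₀ i) : ℕ∞) with hγ
  set δ := algFilterDim K A with hδ
  by_cases hγt : γ = ⊤
  · rw [hγt, ENNReal.top_mul hD]; exact le_top
  lift γ to ℝ≥0 using hγt with c
  lift δ to ℝ≥0 using hd with d
  -- The degrees are infima that need not be attained, so both exponents are enlarged by ε, and ε
  -- then tends to 0.
  have hbound : ∀ ε : ℝ≥0, 0 < ε →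
      growthDegree (fun i => (Module.finrank K (algFiltration V i) : ℕ∞)) ≤
        (((c + ε) * ((d + ε) + max (d + ε) 1) : ℝ≥0) : ℝ≥0∞) := fun ε hε => by
    refine growthDegree_le_mul_of_le_mul_add (fun i j hij => ?_) ?_ ?_
      (g := fun i => Module.finrank K (modFiltration V M₀ i))
      (ν := returnFunction (envelopingSubspace V) (1 : Submodule K A))
    · exact_mod_cast finrank_algFiltration_le hV hM₀ hbot hij
    · rw [← hγ]; exact_mod_cast lt_add_of_pos_right c hε
    · refine (growthDegree_returnFunction_le_algFilterDim hV hV').trans_lt ?_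
      rw [← hδ]; exact_mod_cast lt_add_of_pos_right d hε
  have hlim : Tendsto (fun ε : ℝ≥0 => (((c + ε) * ((d + ε) + max (d + ε) 1) : ℝ≥0) : ℝ≥0∞))
      (nhdsWithin 0 (Set.Ioi 0)) (nhds (((c + 0) * ((d + 0) + max (d + 0) 1) : ℝ≥0) : ℝ≥0∞)) := by
    refine Tendsto.mono_left (Continuous.tendsto ?_ 0) nhdsWithin_le_nhds
    exact ENNReal.continuous_coe.comp (by fun_prop)
  have := ge_of_tendsto hlim (eventually_nhdsWithin_of_forall hbound)
  simpa using this

end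

end FilterInequality

/-! ### The two inequalities for the holonomic number -/

theorem algGKDim_div_le_holonomicNumber (K : Type*) (A : Type u) [Field K] [Ring A] [Algebra K A]
    [IsSimpleRing A] [Algebra.FiniteType K A] :
    algGKDim K A / (algFilterDim K A + max (algFilterDim K A) 1) ≤ holonomicNumber K A := by
  refine le_iInf fun M => le_iInf fun _ => le_iInf fun _ => le_iInf fun _ => le_iInf fun _ =>
    le_iInf fun _ => le_iInf fun _ => ?_
  -- For infinite filter dimension the fraction is 0, even when the numerator is infinite.
  by_cases hd : algFilterDim K A = ⊤
  · rw [hd, top_add, ENNReal.div_top]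
    exact bot_le
  · exact ENNReal.div_le_of_le_mul (algGKDim_le_modGKDim_mul hd)

theorem holonomicNumber_le_modGKDim {K : Type*} {A : Type u} [Field K] [Ring A] [Algebra K A]
    [Algebra.FiniteType K A] {B : Subalgebra K A} {X : Submodule K A} (hX : X.FG) (hX1 : 1 ≤ X)
    (hXB : X * Subalgebra.toSubmodule B = ⊤) (τ : A →ₗ[K] B)
    (hτ : ∀ (a : A) (b : B), τ (a * b) = τ a * b) (hτ1 : τ 1 = 1)
    (M : Type*) [AddCommGroup M] [Module K M] [Module B M] [IsScalarTower K B M] [Nontrivial M]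
    [Module.Finite B M] : holonomicNumber K A ≤ modGKDim K B M := by
  obtain ⟨N, _, _, _, _, ι, _, _, hι⟩ := exists_induced_module τ hτ hτ1 M
  refine le_trans ?_ (modGKDim_le_of_span_range_eq_top hX hX1 hXB ι hι)
  exact iInf_le_of_le N (iInf_le_of_le _ (iInf_le_of_le _ (iInf_le_of_le _ (iInf_le_of_le
    inferInstance (iInf_le_of_le inferInstance (iInf_le_of_le inferInstance le_rfl))))))

theorem mainTheorem9 {K : Type*} {A : Type*} [Field K] [Ring A] [Algebra K A]
    [IsSimpleRing A] [Algebra.FiniteType K A]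
    (G : Subgroup (A ≃ₐ[K] A)) [Finite G] (hG : IsUnit ((Nat.card G : ℕ) : A)) :
    Algebra.FiniteType K (FixedPoints.subalgebra K A G) ∧
    (∀ (M : Type*) [AddCommGroup M] [Module K M] [Module (FixedPoints.subalgebra K A G) M]
      [IsScalarTower K (FixedPoints.subalgebra K A G) M] [Nontrivial M]
      [Module.Finite (FixedPoints.subalgebra K A G) M],
      holonomicNumber K A ≤ modGKDim K (FixedPoints.subalgebra K A G) M) ∧
    algGKDim K A / (algFilterDim K A + max (algFilterDim K A) 1) ≤ holonomicNumber K A := by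
  obtain ⟨X, hX, hX1, hXB⟩ := exists_fg_mul_fixedPoints_eq_top (K := K) hG
  obtain ⟨τ, hτ, hτ1⟩ := exists_reynolds (K := K) hG
  exact ⟨finiteType_of_mul_eq_top hX hX1 hXB τ hτ hτ1,
    fun M _ _ _ _ _ _ => holonomicNumber_le_modGKDim hX hX1 hXB τ hτ hτ1 M,
    algGKDim_div_le_holonomicNumber K A⟩
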